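/- Let $n\ge 0$, $d\ge 1$, and let $F\in\mathbb{R}[t,x_1,\dots,x_n]$ be homogeneous of degree $d$ with $F(e)=1$, where $e=(1,0,\dots,0)\in\mathbb{R}^{n+1}$. $F$ is called hyperbolic with respect to $e$ if $F(e)\ne 0$ and, for every $b\in\mathbb{R}^{n+1}$, all complex roots of the univariate polynomial $F(te-b)\in\mathbb{R}[t]$ are real. It is called strictly hyperbolic with respect to $e$ if it is hyperbolic with respect to $e$ and, for every $b\in\mathbb{R}^{n+1}$ that is not a real multiple of $e$, the roots of $F(te-b)$ are pairwise distinct. For $s\in\mathbb{R}$ define the linear operators $T^{i}_s(P)=P+s\,x_i\,\dfrac{\partial P}{\partial t}$ $(1\le i\le n)$ and $G_s(P)=P(t,sx_1,\dots,sx_n)$ on $\mathbb{R}[t,x_1,\dots,x_n]$, and set $$H_s=(T^{1}_s)^d\cdots(T^{n}_s)^d,\qquad N_s=H_{1-s}\,G_s .$$ For $s\in\mathbb{R}$ and $a\in\mathbb{R}^n$ let $\Delta_N(F)(s,a)$ be the value at $x=a$ of the discriminant of $N_s(F)$ with respect to $t$. 1. If $F$ is hyperbolic with respect to $e$, then $\Delta_N(F)(s,a)\ge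 0$ for all $s\in[0,1]$ and all $a\in\mathbb{R}^n$. 2. Conversely, if $\Delta_N(F)(s,a)>0$ for all $s\in[0,1]$ and all $a\in\mathbb{R}^n\setminus\{0\}$, then $F$ is strictly hyperbolic with respect to $e$. -/

import Mathlib

noncomputable section

namespace NPath

/-- A real univariate polynomial is real rooted if all its complex roots are real. -/
def RealRooted (p : Polynomial ℝ) : Prop :=
  ∀ z : ℂ, Polynomial.aeval z p = 0 → z.im = 0

/-- The univariate polynomial `F(t e - a)` in the variable `t`. -/
def lineRestriction {m : ℕ} (F : MvPolynomial (Fin m) ℝ) (e a : Fin m → ℝ) : Polynomial ℝ :=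
  MvPolynomial.aeval
    (fun i => Polynomial.X * Polynomial.C (e i) - Polynomial.C (a i) : Fin m → Polynomial ℝ) F

/-- Hyperbolicity of a form `F` with respect to the point `e`. -/
def IsHyperbolic {m : ℕ} (F : MvPolynomial (Fin m) ℝ) (e : Fin m → ℝ) : Prop :=
  MvPolynomial.eval e F ≠ 0 ∧ ∀ a : Fin m → ℝ, RealRooted (lineRestriction F e a)

/-- Strict hyperbolicity of a form `F` with respect to `e`: the roots of `F(t e - a)` are all real,
and they are pairwise distinct (no multiple root in `ℂ`) unless `a` is a multiple of `e`. For
`a = c e` with `c` real, `F(t e - a) = (t - c) ^ d F(e)` has a multiple root as soon as `d ≥ 2`. -/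
def IsStrictlyHyperbolic {m : ℕ} (F : MvPolynomial (Fin m) ℝ) (e : Fin m → ℝ) : Prop :=
  IsHyperbolic F e ∧
    ∀ a : Fin m → ℝ, (∀ c : ℝ, a ≠ c • e) → ((lineRestriction F e a).aroots ℂ).Nodup

/-- The point `e = (1, 0, …, 0)`. -/
def e₀ (n : ℕ) : Fin (n + 1) → ℝ := Pi.single 0 1

/-- The set `𝓕` of forms of degree `d` in the variables `t, x₁, …, xₙ` that take the value `1` at
`(1, 0, …, 0)`. The variable `t` has index `0`, and `xᵢ` is the variable with index `i.succ`. -/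
def forms (n d : ℕ) : Set (MvPolynomial (Fin (n + 1)) ℝ) :=
  {F | F.IsHomogeneous d ∧ MvPolynomial.eval (e₀ n) F = 1}

/-- The operator `F ↦ F + s ℓ ∂F/∂t`, for `ℓ` in `ℝ[x₁, …, xₙ]`. -/
def T {n : ℕ} (ℓ : MvPolynomial (Fin n) ℝ) (s : ℝ) :
    Module.End ℝ (MvPolynomial (Fin (n + 1)) ℝ) :=
  LinearMap.id +
    s • (LinearMap.mulLeft ℝ (MvPolynomial.rename Fin.succ ℓ) ∘ₗ
      (MvPolynomial.pderiv (R := ℝ) (0 : Fin (n + 1))).toLinearMap)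

/-- The operator `F(t, x) ↦ F(t, s x)`. -/
def G (n : ℕ) (s : ℝ) : Module.End ℝ (MvPolynomial (Fin (n + 1)) ℝ) :=
  (MvPolynomial.aeval (Fin.cons (MvPolynomial.X 0)
    (fun i : Fin n => MvPolynomial.C s * MvPolynomial.X i.succ) :
      Fin (n + 1) → MvPolynomial (Fin (n + 1)) ℝ)).toLinearMap

/-- The operator `H_s = (T^{x₁}_s)^d ⋯ (T^{xₙ}_s)^d`, a composition of linear operators. -/
def H (n d : ℕ) (s : ℝ) : Module.End ℝ (MvPolynomial (Fin (n + 1)) ℝ) :=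
  ((List.finRange n).map fun i => T (MvPolynomial.X i) s ^ d).prod

/-- The Nuij path operator `N_s = H_{1-s} G_s`. -/
def N (n d : ℕ) (s : ℝ) : Module.End ℝ (MvPolynomial (Fin (n + 1)) ℝ) :=
  H n d (1 - s) * G n s

/-- The discriminant with respect to `t` of a polynomial in `ℝ[t, x₁, …, xₙ]`, an element of
`ℝ[x₁, …, xₙ]`. -/
def tDiscr {n : ℕ} (F : MvPolynomial (Fin (n + 1)) ℝ) : MvPolynomial (Fin n) ℝ :=
  (MvPolynomial.finSuccEquiv ℝ n F).discr

/-- The value at `(s, a)` of the discriminant of the path `s ↦ N_s(F)`. -/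
def pathDiscr {n : ℕ} (d : ℕ) (F : MvPolynomial (Fin (n + 1)) ℝ) (s : ℝ) (a : Fin n → ℝ) : ℝ :=
  MvPolynomial.eval a (tDiscr (N n d s F))

end NPath

end

namespace NPath

open Polynomial

/-! Fix `a` and view `N_s(F)` at `x = a` as a polynomial in `t`, monic of degree `d`. There `G_s`
replaces `a` by `s • a`, and each factor of `H_{1-s}` acts as `p ↦ p + c p'` with `c` real, which
keeps all roots real (`RealRooted.add_C_mul_derivative`). So if `F` is hyperbolic, every slice of
`N_s(F)` is real rooted, and its discriminant is nonnegative (`RealRooted.discr_nonneg`).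

For the converse, at `s = 0` the slice comes from `t ^ d`, hence is real rooted; at `s = 1` it is
the slice of `F`. A nonvanishing discriminant keeps all roots simple along the path. Real-rootedness
is closed among monic polynomials of fixed degree and open at those with simple roots, so
connectedness of `[0, 1]` carries it from `s = 0` to `s = 1` (`realRooted_of_preconnectedSpace`).
Simplicity at `s = 1` gives strictness. -/

/-! ### Real-rooted polynomials and the operator `p ↦ p + c p'` -/

theorem RealRooted.splits {p : ℝ[X]} (hp : RealRooted p) : p.Splits := by
  refine Splits.of_splits_map (algebraMap ℝ ℂ) (IsAlgClosed.splits _) fun z hz => ?_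
  have hz' : aeval z p = 0 := by
    rw [← eval_map_algebraMap]
    exact isRoot_of_mem_roots hz
  exact ⟨z.re, Complex.ext (by simp) (by simp [hp z hz'])⟩

theorem aeval_eq_prod_roots_of_splits {p : ℝ[X]} (hp : p.Splits) (hm : p.Monic) (z : ℂ) :
    aeval z p = (p.roots.map fun r : ℝ => z - r).prod := by
  conv_lhs => rw [hp.eq_prod_roots_of_monic hm]
  simp [map_multiset_prod, Multiset.map_map]

theorem abs_im_pow_card_le_norm_prod (s : Multiset ℝ) (z : ℂ) :
    |z.im| ^ s.card ≤ ‖(s.map fun r : ℝ => z - r).prod‖ := by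
  induction s using Multiset.induction_on with
  | empty => simp
  | cons r s ih =>
    have h : |z.im| ≤ ‖z - r‖ := by simpa using Complex.abs_im_le_norm (z - r)
    rw [Multiset.card_cons, pow_succ', Multiset.map_cons, Multiset.prod_cons, norm_mul]
    gcongr

/-- Each factor `z - r` with `r` real has norm at least `|z.im|`. Unlike real-rootedness itself, the
bound visibly passes to limits. -/
theorem RealRooted.abs_im_pow_natDegree_le {p : ℝ[X]} (hp : RealRooted p) (hm : p.Monic) (z : ℂ) :
    |z.im| ^ p.natDegree ≤ ‖aeval z p‖ := by
  rw [aeval_eq_prod_roots_of_splits hp.splits hm, hp.splits.natDegree_eq_card_roots]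
  exact abs_im_pow_card_le_norm_prod _ _

theorem realRooted_of_splits {p : ℝ[X]} (hp : p.Splits) (hm : p.Monic) : RealRooted p := by
  intro z hz
  rw [aeval_eq_prod_roots_of_splits hp hm, Multiset.prod_eq_zero_iff, Multiset.mem_map] at hz
  obtain ⟨r, -, hr⟩ := hz
  simpa using congrArg Complex.im hr

theorem im_mul_im_one_div_sub_neg {z : ℂ} (hz : z.im ≠ 0) (r : ℝ) :
    z.im * (1 / (z - r)).im < 0 := by
  have h : z - r ≠ 0 := fun h => hz (by simpa using congrArg Complex.im h)
  have h2 : 0 < Complex.normSq (z - r) := Complex.normSq_pos.2 h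
  have h3 : z.im * (1 / (z - r)).im = -(z.im ^ 2 / Complex.normSq (z - r)) := by
    simp [Complex.inv_im]
    ring
  rw [h3, neg_lt_zero]
  positivity

/-- Every `1 / (z - r)` lies in the half-plane opposite to `z`, so no cancellation can occur. The
sum is the logarithmic derivative `p'(z) / p(z)`. -/
theorem im_mul_im_sum_one_div_sub_neg {z : ℂ} (hz : z.im ≠ 0) {s : Multiset ℝ} (hs : s ≠ 0) :
    z.im * (s.map fun r : ℝ => 1 / (z - r)).sum.im < 0 := by
  have hle : ∀ s : Multiset ℝ, z.im * (s.map fun r : ℝ => 1 / (z - r)).sum.im ≤ 0 := by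
    intro s
    induction s using Multiset.induction_on with
    | empty => simp
    | cons r s ih =>
      rw [Multiset.map_cons, Multiset.sum_cons, Complex.add_im, mul_add]
      linarith [im_mul_im_one_div_sub_neg hz r]
  obtain ⟨r, hr⟩ := Multiset.exists_mem_of_ne_zero hs
  obtain ⟨t, rfl⟩ := Multiset.exists_cons_of_mem hr
  rw [Multiset.map_cons, Multiset.sum_cons, Complex.add_im, mul_add]
  linarith [im_mul_im_one_div_sub_neg hz r, hle t]

/-- The operator `p ↦ p + c p'` preserves real-rootedness. -/
theorem RealRooted.add_C_mul_derivative {p : ℝ[X]} (hp : RealRooted p) (hd : p.natDegree ≠ 0)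
    (c : ℝ) : RealRooted (p + C c * derivative p) := by
  intro z hz
  by_contra him
  have hpz : aeval z p ≠ 0 := fun h => him (hp z h)
  have hs : p.roots ≠ 0 := fun h => hd (by rw [hp.splits.natDegree_eq_card_roots, h]; rfl)
  have hneg := im_mul_im_sum_one_div_sub_neg him hs
  have key := (hp.splits.map (algebraMap ℝ ℂ)).eval_derivative_eq_eval_mul_sum (x := z)
    (by rwa [eval_map_algebraMap])
  rw [derivative_map, eval_map_algebraMap, eval_map_algebraMap, hp.splits.roots_map,
    Multiset.map_map] at key
  set S := (p.roots.map fun r : ℝ => 1 / (z - r)).sum with hS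
  have key' : aeval z (derivative p) = aeval z p * S := key
  have h1 : aeval z p * (1 + c * S) = 0 := by
    rw [map_add, map_mul, key', aeval_C] at hz
    rw [← hz, Complex.coe_algebraMap]
    ring
  have h2 : 1 + c * S = 0 := (mul_eq_zero.1 h1).resolve_left hpz
  have h3 : c * S.im = 0 := by simpa using congrArg Complex.im h2
  have hSim : S.im ≠ 0 := fun h => by simp [h] at hneg
  -- Since `S` is not real, `c * S.im = 0` forces `c = 0`, and `1 + c * S = 0` becomes `1 = 0`.
  rw [(mul_eq_zero.1 h3).resolve_right hSim] at h2
  simp at h2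

/-! ### Discriminants of monic polynomials -/

/-- The resultant of `p` and `p'` with prescribed formal degrees commutes with ring maps, and
monicity keeps those degrees unchanged; the sign relating it to the discriminant is a unit. -/
theorem discr_map_of_monic {R S : Type*} [CommRing R] [CommRing S] [Nontrivial R] [Nontrivial S]
    (φ : R →+* S) {p : R[X]} (hm : p.Monic) (hd : p.natDegree ≠ 0) :
    (p.map φ).discr = φ p.discr := by
  have hdeg : (p.map φ).natDegree = p.natDegree := hm.natDegree_map φ
  have h1 := resultant_deriv (f := p) (natDegree_pos_iff_degree_pos.1 (Nat.pos_of_ne_zero hd))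
  have h2 := resultant_deriv (f := p.map φ)
    (natDegree_pos_iff_degree_pos.1 (by rw [hdeg]; exact Nat.pos_of_ne_zero hd))
  rw [derivative_map, hdeg, resultant_map_map, h1, hm.leadingCoeff, (hm.map φ).leadingCoeff] at h2
  have hu : IsUnit ((-1 : S) ^ (p.natDegree * (p.natDegree - 1) / 2)) :=
    (isUnit_one.neg).pow _
  simp only [map_mul, map_pow, map_neg, map_one, mul_one] at h2
  exact (hu.mul_left_cancel h2).symm

theorem prod_map_sub_swap {R : Type*} [CommRing R] (s : Multiset R) (a : R) :
    (s.map fun r => r - a).prod = (-1) ^ s.card * (s.map fun r => a - r).prod := by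
  induction s using Multiset.induction_on with
  | empty => simp
  | cons r s ih =>
    simp only [Multiset.map_cons, Multiset.prod_cons, Multiset.card_cons, ih]
    ring

/-- Adjoining a root `a` to `q` multiplies the expression by `q(a) ^ 2`: one factor is the new
derivative at `a`, the other collects the `r - a` up to the sign `(-1) ^ s.card`, which the growth
of the exponent cancels. -/
theorem sign_mul_prod_eval_derivative_nonneg (s : Multiset ℝ) :
    0 ≤ (-1 : ℝ) ^ (s.card * (s.card - 1) / 2) *
      (s.map fun r => (derivative (s.map fun r => X - C r).prod).eval r).prod := by
  induction s using Multiset.induction_on with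
  | empty => simp
  | cons a s ih =>
    set q := (s.map fun r => X - C r).prod with hq
    have hqa : q.eval a = (s.map fun r => a - r).prod := by
      rw [hq, eval_multiset_prod, Multiset.map_map]
      simp
    have hder : derivative ((X - C a) * q) = q + (X - C a) * derivative q := by
      rw [derivative_mul]
      simp
    have hroot : ∀ r ∈ s, q.eval r = 0 := by
      intro r hr
      rw [hq, eval_multiset_prod, Multiset.map_map]
      exact Multiset.prod_eq_zero (Multiset.mem_map.2 ⟨r, hr, by simp⟩)
    have hprod : (s.map fun r => (derivative ((X - C a) * q)).eval r).prod =
        (s.map fun r => r - a).prod * (s.map fun r => (derivative q).eval r).prod := by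
      rw [← Multiset.prod_map_mul]
      congr 1
      refine Multiset.map_congr rfl fun r hr => ?_
      rw [hder]
      simp [hroot r hr]
    have hcard : (s.card + 1) * (s.card + 1 - 1) / 2 = s.card * (s.card - 1) / 2 + s.card := by
      rw [← Nat.triangle_succ]
    rw [Multiset.map_cons, Multiset.map_cons, Multiset.prod_cons, Multiset.prod_cons,
      Multiset.card_cons, ← hq, hprod, prod_map_sub_swap, ← hqa, hcard, hder]
    have hsq : ((-1 : ℝ) ^ s.card) * (-1) ^ s.card = 1 := by
      rw [← mul_pow]
      simp
    have : (-1 : ℝ) ^ (s.card * (s.card - 1) / 2 + s.card) *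
        ((q + (X - C a) * derivative q).eval a *
          ((-1) ^ s.card * q.eval a * (s.map fun r => (derivative q).eval r).prod)) =
        (((-1 : ℝ) ^ s.card) * (-1) ^ s.card) * (q.eval a ^ 2 *
          ((-1 : ℝ) ^ (s.card * (s.card - 1) / 2) *
            (s.map fun r => (derivative q).eval r).prod)) := by
      simp only [eval_add, eval_mul, eval_sub, eval_X, eval_C, pow_add]
      ring
    rw [this, hsq, one_mul]
    positivity

/-- The discriminant of a monic polynomial with only real roots is nonnegative. -/
theorem RealRooted.discr_nonneg {p : ℝ[X]} (hp : RealRooted p) (hm : p.Monic)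
    (hd : p.natDegree ≠ 0) : 0 ≤ p.discr := by
  have h1 := resultant_deriv (f := p) (natDegree_pos_iff_degree_pos.1 (Nat.pos_of_ne_zero hd))
  rw [resultant_eq_prod_eval _ _ _ (natDegree_derivative_le p) hp.splits, hm.leadingCoeff, one_pow,
    one_mul, mul_one] at h1
  have h2 := sign_mul_prod_eval_derivative_nonneg p.roots
  rw [← hp.splits.eq_prod_roots_of_monic hm, ← hp.splits.natDegree_eq_card_roots, h1, ← mul_assoc,
    ← mul_pow] at h2
  simpa using h2

theorem separable_of_discr_ne_zero {p : ℝ[X]} (hm : p.Monic) (hd : p.natDegree ≠ 0)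
    (h : p.discr ≠ 0) : p.Separable := by
  have h1 := resultant_deriv (f := p) (natDegree_pos_iff_degree_pos.1 (Nat.pos_of_ne_zero hd))
  have hdeg : (derivative p).natDegree = p.natDegree - 1 := natDegree_derivative p
  rw [hm.leadingCoeff, mul_one] at h1
  rw [Polynomial.Separable, ← isUnit_resultant_iff_isCoprime hm, hdeg, h1, isUnit_iff_ne_zero]
  exact mul_ne_zero (pow_ne_zero _ (by norm_num)) h

/-! ### Real-rootedness in continuous families -/

theorem continuous_aeval_of_coeff {A : Type*} [CommRing A] [TopologicalSpace A]
    [IsTopologicalRing A] [Algebra ℝ A] [ContinuousSMul ℝ A] {S : Type*} [TopologicalSpace S]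
    {f : S → ℝ[X]} {d : ℕ} (hdeg : ∀ s, (f s).natDegree ≤ d)
    (hc : ∀ k, Continuous fun s => (f s).coeff k) (x : A) :
    Continuous fun s => aeval x (f s) := by
  have h : (fun s => aeval x (f s)) =
      fun s => ∑ k ∈ Finset.range (d + 1), (f s).coeff k • x ^ k := by
    funext s
    exact aeval_eq_sum_range' (Nat.lt_succ_of_le (hdeg s)) x
  rw [h]
  exact continuous_finsetSum _ fun k _ => (hc k).smul continuous_const

theorem eventually_eval_mul_eval_neg {p : ℝ[X]} (hp : p.Separable) {r : ℝ} (hr : p.IsRoot r) :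
    ∀ᶠ δ in nhdsWithin (0 : ℝ) (Set.Ioi 0), p.eval (r - δ) * p.eval (r + δ) < 0 := by
  obtain ⟨q, rfl⟩ := dvd_iff_isRoot.2 hr
  have hq : q.eval r ≠ 0 := by
    intro h
    have := hp.eval₂_derivative_ne_zero (RingHom.id ℝ) (x := r) (by simp)
    simp [derivative_mul, h] at this
  have hc : Continuous fun δ : ℝ => q.eval (r - δ) * q.eval (r + δ) := by fun_prop
  have hpos : ∀ᶠ δ in nhds (0 : ℝ), 0 < q.eval (r - δ) * q.eval (r + δ) := by
    refine hc.continuousAt.eventually (lt_mem_nhds ?_)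
    simpa using mul_self_pos.2 hq
  filter_upwards [nhdsWithin_le_nhds hpos, self_mem_nhdsWithin] with δ h1 h2
  have h3 : 0 < δ := h2
  have : eval (r - δ) ((X - C r) * q) * eval (r + δ) ((X - C r) * q) =
      -(δ ^ 2 * (q.eval (r - δ) * q.eval (r + δ))) := by
    simp only [eval_mul, eval_sub, eval_X, eval_C]
    ring
  rw [this, neg_lt_zero]
  positivity

theorem exists_root_mem_Icc_of_mul_neg {p : ℝ[X]} {r δ : ℝ} (hδ : 0 < δ)
    (h : p.eval (r - δ) * p.eval (r + δ) < 0) : ∃ x ∈ Set.Icc (r - δ) (r + δ), p.IsRoot x := by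
  have hle : r - δ ≤ r + δ := by linarith
  have h0 : (0 : ℝ) ∈ Set.uIcc (p.eval (r - δ)) (p.eval (r + δ)) := by
    rw [Set.mem_uIcc]
    rcases mul_neg_iff.1 h with h | h
    · exact Or.inr ⟨h.2.le, h.1.le⟩
    · exact Or.inl ⟨h.1.le, h.2.le⟩
  obtain ⟨x, hx, hx0⟩ := intermediate_value_uIcc p.continuous.continuousOn h0
  rw [Set.uIcc_of_le hle] at hx
  exact ⟨x, hx, hx0⟩

/-- In a continuous family of monic polynomials of fixed degree, having only real roots is an open
condition at a member with simple roots. -/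
theorem eventually_realRooted {S : Type*} [TopologicalSpace S] {f : S → ℝ[X]} {d : ℕ}
    (hmon : ∀ s, IsMonicOfDegree (f s) d) (hc : ∀ k, Continuous fun s => (f s).coeff k) {s₀ : S}
    (hreal : RealRooted (f s₀)) (hsep : (f s₀).Separable) :
    ∀ᶠ s in nhds s₀, RealRooted (f s) := by
  set R := (f s₀).roots.toFinset with hR
  have hroot : ∀ r ∈ R, (f s₀).IsRoot r := fun r hr =>
    isRoot_of_mem_roots (Multiset.mem_toFinset.1 hr)
  have hcard : R.card = d := by
    rw [hR, Multiset.toFinset_card_of_nodup (nodup_roots hsep),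
      ← hreal.splits.natDegree_eq_card_roots, (hmon s₀).natDegree_eq]
  have h1 : ∀ᶠ δ in nhdsWithin (0 : ℝ) (Set.Ioi 0), ∀ r ∈ R,
      (f s₀).eval (r - δ) * (f s₀).eval (r + δ) < 0 :=
    (Filter.eventually_all_finset R).2 fun r hr => eventually_eval_mul_eval_neg hsep (hroot r hr)
  -- This makes the intervals of radius `δ` around the roots disjoint, so sign changes in them yield
  -- `d` distinct real roots of nearby members.
  have h2 : ∀ᶠ δ in nhdsWithin (0 : ℝ) (Set.Ioi 0), ∀ r ∈ R, ∀ r' ∈ R, r ≠ r' →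
      2 * δ < |r - r'| := by
    refine (Filter.eventually_all_finset R).2 fun r _ => (Filter.eventually_all_finset R).2
      fun r' _ => ?_
    by_cases h : r = r'
    · simp [h]
    · have hcont : Continuous fun δ : ℝ => 2 * δ := by fun_prop
      have : ∀ᶠ δ in nhds (0 : ℝ), 2 * δ < |r - r'| :=
        hcont.continuousAt.eventually (gt_mem_nhds (by simpa [sub_eq_zero] using h))
      filter_upwards [nhdsWithin_le_nhds this] with δ hδ _ using hδ
  obtain ⟨δ, ⟨hsign, hδsep⟩, hδ⟩ := ((h1.and h2).and self_mem_nhdsWithin).exists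
  have hδ0 : (0 : ℝ) < δ := hδ
  have hev : ∀ x, Continuous fun s => (f s).eval x := fun x => by
    simpa using continuous_aeval_of_coeff (fun s => (hmon s).natDegree_eq.le) hc x
  have h3 : ∀ᶠ s in nhds s₀, ∀ r ∈ R, (f s).eval (r - δ) * (f s).eval (r + δ) < 0 :=
    (Filter.eventually_all_finset R).2 fun r hr =>
      ((hev _).mul (hev _)).continuousAt.eventually (gt_mem_nhds (hsign r hr))
  filter_upwards [h3] with s hs
  choose! g hg using fun r hr => exists_root_mem_Icc_of_mul_neg hδ0 (hs r hr)
  have hinj : Set.InjOn g R := by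
    intro r hr r' hr' heq
    by_contra hne
    have hlt := hδsep r hr r' hr' hne
    have ha := (hg r hr).1
    have hb := (hg r' hr').1
    rw [← heq] at hb
    have : |r - r'| ≤ 2 * δ := abs_le.2 ⟨by linarith [ha.1, ha.2, hb.1, hb.2],
      by linarith [ha.1, ha.2, hb.1, hb.2]⟩
    linarith
  have hsub : R.image g ⊆ (f s).roots.toFinset := by
    intro x hx
    obtain ⟨r, hr, rfl⟩ := Finset.mem_image.1 hx
    exact Multiset.mem_toFinset.2 ((mem_roots (hmon s).monic.ne_zero).2 (hg r hr).2)
  have hle : d ≤ (f s).roots.card := by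
    rw [← hcard, ← Finset.card_image_of_injOn hinj]
    exact (Finset.card_le_card hsub).trans (Multiset.toFinset_card_le _)
  refine realRooted_of_splits (splits_iff_card_roots.2 (le_antisymm (card_roots' _) ?_))
    (hmon s).monic
  rwa [(hmon s).natDegree_eq]

/-- In a continuous family of monic polynomials of fixed degree, having only real roots is a closed
condition. -/
theorem isClosed_setOf_realRooted {S : Type*} [TopologicalSpace S] {f : S → ℝ[X]} {d : ℕ}
    (hmon : ∀ s, IsMonicOfDegree (f s) d) (hc : ∀ k, Continuous fun s => (f s).coeff k) :
    IsClosed {s | RealRooted (f s)} := by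
  -- The inequality at a root `z` reads `|z.im| ^ d ≤ 0`, so it characterizes real-rootedness by
  -- closed conditions.
  have h : {s | RealRooted (f s)} = ⋂ z : ℂ, {s | |z.im| ^ d ≤ ‖aeval z (f s)‖} := by
    ext s
    simp only [Set.mem_ofPred_eq, Set.mem_iInter]
    refine ⟨fun h z => ?_, fun h z hz => ?_⟩
    · simpa [(hmon s).natDegree_eq] using h.abs_im_pow_natDegree_le (hmon s).monic z
    · have := h z
      rw [hz, norm_zero] at this
      simpa using eq_zero_of_pow_eq_zero (le_antisymm this (by positivity))
  rw [h]
  exact isClosed_iInter fun z => isClosed_le continuous_const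
    (continuous_aeval_of_coeff (fun s => (hmon s).natDegree_eq.le) hc z).norm

theorem realRooted_of_preconnectedSpace {S : Type*} [TopologicalSpace S] [PreconnectedSpace S]
    {f : S → ℝ[X]} {d : ℕ} (hmon : ∀ s, IsMonicOfDegree (f s) d)
    (hc : ∀ k, Continuous fun s => (f s).coeff k) (hsep : ∀ s, (f s).Separable)
    {s₀ : S} (h₀ : RealRooted (f s₀)) (s : S) : RealRooted (f s) := by
  have hopen : IsOpen {s | RealRooted (f s)} := isOpen_iff_mem_nhds.2 fun t ht =>
    eventually_realRooted hmon hc ht (hsep t)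
  have huniv := IsClopen.eq_univ ⟨isClosed_setOf_realRooted hmon hc, hopen⟩ ⟨s₀, h₀⟩
  exact huniv.symm.subset (Set.mem_univ s)


/-! ### Slices at a fixed `x = a`, and the action of the Nuij operators on them -/

/-- The univariate polynomial `P(t, a)`. -/
noncomputable def slice {n : ℕ} (a : Fin n → ℝ) (P : MvPolynomial (Fin (n + 1)) ℝ) : ℝ[X] :=
  (MvPolynomial.finSuccEquiv ℝ n P).map (MvPolynomial.eval a)

/-- `P` is monic of degree `d` in the variable `t`. -/
def MonicInT {n : ℕ} (d : ℕ) (P : MvPolynomial (Fin (n + 1)) ℝ) : Prop :=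
  IsMonicOfDegree (MvPolynomial.finSuccEquiv ℝ n P) d

theorem isMonicOfDegree_map {R S : Type*} [CommRing R] [CommRing S] [Nontrivial S] (φ : R →+* S)
    {p : R[X]} {d : ℕ} (hp : IsMonicOfDegree p d) : IsMonicOfDegree (p.map φ) d :=
  ⟨by rw [hp.monic.natDegree_map, hp.natDegree_eq], hp.monic.map φ⟩

theorem MonicInT.isMonicOfDegree_slice {n d : ℕ} {P : MvPolynomial (Fin (n + 1)) ℝ}
    (hP : MonicInT d P) (a : Fin n → ℝ) : IsMonicOfDegree (slice a P) d :=
  isMonicOfDegree_map _ hP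

theorem MonicInT.eval_tDiscr {n d : ℕ} (hd : d ≠ 0) {P : MvPolynomial (Fin (n + 1)) ℝ}
    (hP : MonicInT d P) (a : Fin n → ℝ) :
    MvPolynomial.eval a (tDiscr P) = (slice a P).discr :=
  (discr_map_of_monic _ hP.monic (by rwa [hP.natDegree_eq])).symm

theorem coeff_slice_of_isHomogeneous {n d k : ℕ} {F : MvPolynomial (Fin (n + 1)) ℝ}
    (hF : F.IsHomogeneous d) (hk : k < d) : (slice 0 F).coeff k = 0 := by
  have h := hF.finSuccEquiv_coeff_isHomogeneous k (d - k) (by omega)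
  rw [slice, coeff_map]
  simpa [MvPolynomial.constantCoeff_eq, MvPolynomial.eval_zero] using
    h.coeff_eq_zero (d := 0) (by simp; omega)

/-- By homogeneity the coefficient of `t ^ d` is a constant, and on the line `x = 0` only that term
survives, so `F(e) = 1` determines it. -/
theorem monicInT_of_mem_forms {n d : ℕ} {F : MvPolynomial (Fin (n + 1)) ℝ} (hF : F ∈ forms n d) :
    MonicInT d F := by
  obtain ⟨hhom, hone⟩ := hF
  have hdeg : (MvPolynomial.finSuccEquiv ℝ n F).natDegree ≤ d := by
    rw [MvPolynomial.natDegree_finSuccEquiv]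
    exact (MvPolynomial.degreeOf_le_totalDegree _ _).trans hhom.totalDegree_le
  obtain ⟨c, hc⟩ : ∃ c, (MvPolynomial.finSuccEquiv ℝ n F).coeff d = MvPolynomial.C c :=
    ⟨_, MvPolynomial.totalDegree_eq_zero_iff_eq_C.1 (Nat.le_zero.1
      (hhom.finSuccEquiv_coeff_isHomogeneous d 0 (by simp)).totalDegree_le)⟩
  have hval : (slice 0 F).eval 1 = 1 := by
    have h := MvPolynomial.eval_polynomial_eval_finSuccEquiv (x := (0 : Fin n → ℝ)) F 1
    rw [← eval₂_at_apply, map_one, ← eval_map] at h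
    refine h.trans (Eq.trans ?_ hone)
    congr 2
    funext i
    refine Fin.cases ?_ (fun j => ?_) i <;> simp [e₀]
  have hsdeg : (slice 0 F).natDegree ≤ d := natDegree_map_le.trans hdeg
  have hsum : (slice 0 F).eval 1 = c := by
    rw [eval_eq_sum_range' (Nat.lt_succ_of_le hsdeg), Finset.sum_range_succ, Finset.sum_eq_zero]
    · simp [slice, hc]
    · intro k hk
      rw [coeff_slice_of_isHomogeneous hhom (Finset.mem_range.1 hk), zero_mul]
  refine (isMonicOfDegree_iff _ _).2 ⟨hdeg, ?_⟩
  rw [hc, ← hsum, hval, map_one]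

theorem slice_zero_of_mem_forms {n d : ℕ} {F : MvPolynomial (Fin (n + 1)) ℝ} (hF : F ∈ forms n d) :
    slice 0 F = X ^ d := by
  have h := (monicInT_of_mem_forms hF).isMonicOfDegree_slice 0
  ext k
  rw [coeff_X_pow]
  rcases lt_trichotomy k d with hk | rfl | hk
  · rw [coeff_slice_of_isHomogeneous hF.1 hk, if_neg hk.ne]
  · rw [if_pos rfl, ((isMonicOfDegree_iff _ _).1 h).2]
  · rw [if_neg hk.ne', coeff_eq_zero_of_natDegree_lt (h.natDegree_eq ▸ hk)]

theorem finSuccEquiv_pderiv_zero {n : ℕ} (P : MvPolynomial (Fin (n + 1)) ℝ) :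
    MvPolynomial.finSuccEquiv ℝ n (MvPolynomial.pderiv 0 P) =
      derivative (MvPolynomial.finSuccEquiv ℝ n P) := by
  induction P using MvPolynomial.induction_on with
  | C c => simp [MvPolynomial.finSuccEquiv_apply]
  | add p q hp hq => simp only [map_add, hp, hq]
  | mul_X p i hp =>
    rw [Derivation.leibniz, smul_eq_mul, smul_eq_mul, map_add, map_mul, map_mul, map_mul, hp,
      derivative_mul]
    refine Fin.cases ?_ (fun j => ?_) i
    · simp only [MvPolynomial.pderiv_X_self, MvPolynomial.finSuccEquiv_X_zero, map_one,
        derivative_X]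
      ring
    · rw [MvPolynomial.pderiv_X_of_ne (Fin.succ_ne_zero j), MvPolynomial.finSuccEquiv_X_succ,
        map_zero, derivative_C]
      ring

theorem finSuccEquiv_T {n : ℕ} (i : Fin n) (s : ℝ) (P : MvPolynomial (Fin (n + 1)) ℝ) :
    MvPolynomial.finSuccEquiv ℝ n (T (MvPolynomial.X i) s P) =
      MvPolynomial.finSuccEquiv ℝ n P + C (MvPolynomial.C s * MvPolynomial.X i) *
        derivative (MvPolynomial.finSuccEquiv ℝ n P) := by
  have h : T (MvPolynomial.X i) s P =
      P + s • (MvPolynomial.X i.succ * MvPolynomial.pderiv 0 P) := by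
    simp [T]
  rw [h, map_add, map_smul, map_mul, finSuccEquiv_pderiv_zero, MvPolynomial.finSuccEquiv_X_succ,
    C_mul, mul_assoc, Algebra.smul_def, Polynomial.algebraMap_apply, MvPolynomial.algebraMap_eq]

theorem slice_T {n : ℕ} (a : Fin n → ℝ) (i : Fin n) (s : ℝ) (P : MvPolynomial (Fin (n + 1)) ℝ) :
    slice a (T (MvPolynomial.X i) s P) = slice a P + C (s * a i) * derivative (slice a P) := by
  simp [slice, finSuccEquiv_T, derivative_map]

theorem finSuccEquiv_G {n : ℕ} (s : ℝ) (P : MvPolynomial (Fin (n + 1)) ℝ) :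
    MvPolynomial.finSuccEquiv ℝ n (G n s P) = (MvPolynomial.finSuccEquiv ℝ n P).map
      (MvPolynomial.aeval fun i : Fin n =>
        (MvPolynomial.C s * MvPolynomial.X i : MvPolynomial (Fin n) ℝ)).toRingHom := by
  induction P using MvPolynomial.induction_on with
  | C c => simp [G, MvPolynomial.finSuccEquiv_apply]
  | add p q hp hq => simp only [map_add, hp, hq, Polynomial.map_add]
  | mul_X p i hp =>
    have h : G n s (p * MvPolynomial.X i) = G n s p * G n s (MvPolynomial.X i) := by simp [G]
    rw [h, map_mul, map_mul, hp, Polynomial.map_mul]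
    refine congrArg _ ?_
    refine Fin.cases ?_ (fun j => ?_) i
    · have h0 : G n s (MvPolynomial.X 0) = MvPolynomial.X 0 := by simp [G]
      rw [h0, MvPolynomial.finSuccEquiv_X_zero, Polynomial.map_X]
    · have hj : G n s (MvPolynomial.X j.succ) = s • MvPolynomial.X j.succ := by
        simp [G, MvPolynomial.smul_eq_C_mul]
      rw [hj, map_smul, MvPolynomial.finSuccEquiv_X_succ, Polynomial.map_C, Algebra.smul_def,
        Polynomial.algebraMap_apply, MvPolynomial.algebraMap_eq, ← C_mul]
      simp

theorem slice_G {n : ℕ} (a : Fin n → ℝ) (s : ℝ) (P : MvPolynomial (Fin (n + 1)) ℝ) :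
    slice a (G n s P) = slice (s • a) P := by
  have h : (MvPolynomial.eval a).comp (MvPolynomial.aeval fun i : Fin n =>
      (MvPolynomial.C s * MvPolynomial.X i : MvPolynomial (Fin n) ℝ)).toRingHom =
      MvPolynomial.eval (s • a) := by
    refine MvPolynomial.ringHom_ext (fun r => ?_) fun i => ?_ <;> simp
  rw [slice, slice, finSuccEquiv_G, Polynomial.map_map, h]

theorem MonicInT.T {n d : ℕ} (hd : d ≠ 0) {P : MvPolynomial (Fin (n + 1)) ℝ} (hP : MonicInT d P)
    (i : Fin n) (s : ℝ) : MonicInT d (T (MvPolynomial.X i) s P) := by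
  rw [MonicInT, finSuccEquiv_T]
  refine IsMonicOfDegree.add_right hP ((natDegree_C_mul_le _ _).trans_lt ?_)
  refine natDegree_derivative_lt ?_ |>.trans_eq hP.natDegree_eq
  rwa [hP.natDegree_eq]

theorem MonicInT.G {n d : ℕ} {P : MvPolynomial (Fin (n + 1)) ℝ} (hP : MonicInT d P) (s : ℝ) :
    MonicInT d (G n s P) := by
  rw [MonicInT, finSuccEquiv_G]
  exact isMonicOfDegree_map _ hP

/-- A property of families of vectors that is stable under each family of operators `f i` is stable
under products of powers of these. -/
theorem prod_map_pow_induction {S R M ι : Type*} [Semiring R] [AddCommMonoid M] [Module R M]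
    {p : (S → M) → Prop} {f : ι → S → Module.End R M}
    (hf : ∀ i P, p P → p fun s => f i s (P s)) (d : ℕ) (l : List ι) {P : S → M} (hP : p P) :
    p fun s => (l.map fun i => f i s ^ d).prod (P s) := by
  induction l with
  | nil => simpa using hP
  | cons i l ih =>
    have hpow : ∀ k : ℕ, ∀ Q : S → M, p Q → p fun s => (f i s ^ k) (Q s) := by
      intro k
      induction k with
      | zero => intro Q hQ; simpa using hQ
      | succ k ihk =>
        intro Q hQ
        simp only [pow_succ, Module.End.mul_apply]
        exact ihk _ (hf i Q hQ)
    simpa only [List.map_cons, List.prod_cons, Module.End.mul_apply] using hpow d _ ih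

theorem MonicInT.H {n d : ℕ} (hd : d ≠ 0) {P : MvPolynomial (Fin (n + 1)) ℝ} (hP : MonicInT d P)
    (s : ℝ) : MonicInT d (H n d s P) :=
  -- The one-point index set turns the induction for families into one for a single polynomial;
  -- continuity in `s` uses index set `ℝ`.
  prod_map_pow_induction (S := Unit) (p := fun Q => MonicInT d (Q ()))
    (f := fun i _ => NPath.T (MvPolynomial.X i) s) (fun i _ hQ => MonicInT.T hd hQ i s) d
    (List.finRange n) (P := fun _ => P) hP

theorem MonicInT.N {n d : ℕ} (hd : d ≠ 0) {P : MvPolynomial (Fin (n + 1)) ℝ} (hP : MonicInT d P)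
    (s : ℝ) : MonicInT d (N n d s P) :=
  (hP.G s).H hd (1 - s)

theorem realRooted_slice_N {n d : ℕ} (hd : d ≠ 0) {P : MvPolynomial (Fin (n + 1)) ℝ}
    (hP : MonicInT d P) (a : Fin n → ℝ) (s : ℝ) (hr : RealRooted (slice (s • a) P)) :
    RealRooted (slice a (N n d s P)) :=
  (prod_map_pow_induction (S := Unit)
    (p := fun Q => MonicInT d (Q ()) ∧ RealRooted (slice a (Q ())))
    (f := fun i _ => NPath.T (MvPolynomial.X i) (1 - s)) (fun i _ hQ => ⟨hQ.1.T hd i _, by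
      rw [slice_T]
      refine hQ.2.add_C_mul_derivative ?_ _
      rwa [(hQ.1.isMonicOfDegree_slice a).natDegree_eq]⟩) d
    (List.finRange n) (P := fun _ => G n s P) ⟨hP.G s, by rwa [slice_G]⟩).2

theorem continuous_coeff_slice {n : ℕ} (P : MvPolynomial (Fin (n + 1)) ℝ) (k : ℕ) :
    Continuous fun a : Fin n → ℝ => (slice a P).coeff k := by
  simp only [slice, coeff_map]
  exact MvPolynomial.continuous_eval _

theorem continuous_coeff_slice_N {n d : ℕ} (P : MvPolynomial (Fin (n + 1)) ℝ) (a : Fin n → ℝ)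
    (k : ℕ) : Continuous fun s : ℝ => (slice a (N n d s P)).coeff k := by
  refine prod_map_pow_induction (S := ℝ)
    (p := fun Q => ∀ k, Continuous fun s => (slice a (Q s)).coeff k)
    (f := fun i s => T (MvPolynomial.X i) (1 - s)) (fun i Q hQ k => ?_) d
    (List.finRange n) (P := fun s => G n s P) (fun k => ?_) k
  · simp only [slice_T, coeff_add, coeff_C_mul, coeff_derivative]
    have := hQ k
    have := hQ (k + 1)
    fun_prop
  · simp only [slice_G]
    exact (continuous_coeff_slice P k).comp (by fun_prop)

theorem slice_N_one {n d : ℕ} (P : MvPolynomial (Fin (n + 1)) ℝ) (a : Fin n → ℝ) :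
    slice a (N n d 1 P) = slice a P := by
  have hT : ∀ i : Fin n, T (MvPolynomial.X i) 0 = 1 := fun i =>
    LinearMap.ext fun P => by simp [T]
  have hH : H n d 0 = 1 := by simp [H, hT]
  simp [N, hH, slice_G]

/-! ### From slices to hyperbolicity -/

/-- The vector `t e - b` is `(t - b₀, -b₁, …, -bₙ)`, so hyperbolicity only concerns slices up to
translation in `t`. -/
theorem lineRestriction_e₀ {n : ℕ} (P : MvPolynomial (Fin (n + 1)) ℝ) (b : Fin (n + 1) → ℝ) :
    lineRestriction P (e₀ n) b = (slice (fun i => -b i.succ) P).comp (X - C (b 0)) := by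
  induction P using MvPolynomial.induction_on with
  | C c => simp [lineRestriction, slice, MvPolynomial.finSuccEquiv_apply, Polynomial.algebraMap_eq]
  | add p q hp hq => simp_all [lineRestriction, slice]
  | mul_X p i hp =>
    have h1 : lineRestriction (p * MvPolynomial.X i) (e₀ n) b = lineRestriction p (e₀ n) b *
        (X * C (e₀ n i) - C (b i)) := by simp [lineRestriction]
    rw [h1, hp, slice, slice, map_mul, Polynomial.map_mul, mul_comp]
    congr 1
    refine Fin.cases ?_ (fun j => ?_) i
    · simp [e₀, MvPolynomial.finSuccEquiv_X_zero]
    · simp [e₀, MvPolynomial.finSuccEquiv_X_succ]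

theorem RealRooted.comp_X_sub_C {p : ℝ[X]} (hp : RealRooted p) (c : ℝ) :
    RealRooted (p.comp (X - C c)) := by
  intro z hz
  rw [aeval_comp] at hz
  simpa using hp _ hz

theorem separable_comp_X_sub_C {p : ℝ[X]} (hp : p.Separable) (c : ℝ) :
    (p.comp (X - C c)).Separable := by
  have h := IsCoprime.map hp (compRingHom (X - C c))
  simpa [Polynomial.Separable, derivative_comp] using h

theorem IsHyperbolic.realRooted_slice {n : ℕ} {F : MvPolynomial (Fin (n + 1)) ℝ}
    (hF : IsHyperbolic F (e₀ n)) (a : Fin n → ℝ) : RealRooted (slice a F) := by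
  have h := hF.2 (Fin.cons 0 (-a))
  rw [lineRestriction_e₀] at h
  simpa using h

theorem separable_slice_N_of_pathDiscr_ne_zero {n d : ℕ} (hd : d ≠ 0)
    {F : MvPolynomial (Fin (n + 1)) ℝ} (hF : F ∈ forms n d) {s : ℝ} {a : Fin n → ℝ}
    (h : pathDiscr d F s a ≠ 0) : (slice a (N n d s F)).Separable := by
  have hm := (monicInT_of_mem_forms hF).N hd s
  have hms := hm.isMonicOfDegree_slice a
  refine separable_of_discr_ne_zero hms.monic (by rwa [hms.natDegree_eq]) ?_
  rwa [← hm.eval_tDiscr hd]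

theorem realRooted_X_pow (d : ℕ) : RealRooted (X ^ d : ℝ[X]) :=
  realRooted_of_splits (Splits.X_pow d) (monic_X_pow d)

/-- If the discriminant does not vanish along the Nuij path, the path connects `P(t, a)` to a
polynomial with only real roots through polynomials with simple roots. -/
theorem realRooted_slice_of_pathDiscr_ne_zero {n d : ℕ} (hd : d ≠ 0)
    {F : MvPolynomial (Fin (n + 1)) ℝ} (hF : F ∈ forms n d) {a : Fin n → ℝ}
    (h : ∀ s ∈ Set.Icc (0 : ℝ) 1, pathDiscr d F s a ≠ 0) : RealRooted (slice a F) := by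
  have hm := monicInT_of_mem_forms hF
  have h₀ : RealRooted (slice a (N n d 0 F)) := by
    refine realRooted_slice_N hd hm a 0 ?_
    rw [zero_smul, slice_zero_of_mem_forms hF]
    exact realRooted_X_pow d
  have h₁ := realRooted_of_preconnectedSpace (S := unitInterval)
    (f := fun s => slice a (N n d s F)) (d := d) (s₀ := 0)
    (fun s => (hm.N hd s).isMonicOfDegree_slice a)
    (fun k => (continuous_coeff_slice_N F a k).comp continuous_subtype_val)
    (fun s => separable_slice_N_of_pathDiscr_ne_zero hd hF (h s s.2)) (by simpa using h₀) 1
  simpa [slice_N_one] using h₁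

theorem pathDiscr_nonneg_of_isHyperbolic {n d : ℕ} (hd : d ≠ 0)
    {F : MvPolynomial (Fin (n + 1)) ℝ} (hF : F ∈ forms n d) (hhyp : IsHyperbolic F (e₀ n))
    (s : ℝ) (a : Fin n → ℝ) : 0 ≤ pathDiscr d F s a := by
  have hm := monicInT_of_mem_forms hF
  have hms := (hm.N hd s).isMonicOfDegree_slice a
  rw [pathDiscr, (hm.N hd s).eval_tDiscr hd]
  exact (realRooted_slice_N hd hm a s (hhyp.realRooted_slice _)).discr_nonneg hms.monic
    (by rwa [hms.natDegree_eq])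

theorem isStrictlyHyperbolic_of_pathDiscr_ne_zero {n d : ℕ} (hd : d ≠ 0)
    {F : MvPolynomial (Fin (n + 1)) ℝ} (hF : F ∈ forms n d)
    (h : ∀ s ∈ Set.Icc (0 : ℝ) 1, ∀ a : Fin n → ℝ, a ≠ 0 → pathDiscr d F s a ≠ 0) :
    IsStrictlyHyperbolic F (e₀ n) := by
  refine ⟨⟨by rw [hF.2]; exact one_ne_zero, fun b => ?_⟩, fun b hb => ?_⟩
  · rw [lineRestriction_e₀]
    refine RealRooted.comp_X_sub_C ?_ _
    -- The discriminant hypothesis says nothing at the origin, but there the slice is `t ^ d`.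
    by_cases ha : (fun i : Fin n => -b i.succ) = 0
    · rw [ha, slice_zero_of_mem_forms hF]
      exact realRooted_X_pow d
    · exact realRooted_slice_of_pathDiscr_ne_zero hd hF fun s hs => h s hs _ ha
  · have ha : (fun i : Fin n => -b i.succ) ≠ 0 := by
      intro ha
      refine hb (b 0) (funext fun i => ?_)
      refine Fin.cases (by simp [e₀]) (fun j => ?_) i
      simpa [e₀] using congrFun ha j
    rw [lineRestriction_e₀]
    -- The endpoint `s = 1` suffices, because `N_1` is the identity.
    have hsep := separable_slice_N_of_pathDiscr_ne_zero hd hF (h 1 (by simp) _ ha)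
    rw [slice_N_one] at hsep
    exact nodup_roots (separable_comp_X_sub_C hsep _).map

end NPath

theorem mainTheorem2 (n d : ℕ) (hd : 1 ≤ d)
    (F : MvPolynomial (Fin (n + 1)) ℝ) (hF : F ∈ NPath.forms n d) :
    (NPath.IsHyperbolic F (NPath.e₀ n) →
      ∀ s ∈ Set.Icc (0 : ℝ) 1, ∀ a : Fin n → ℝ, 0 ≤ NPath.pathDiscr d F s a) ∧
    ((∀ s ∈ Set.Icc (0 : ℝ) 1, ∀ a : Fin n → ℝ, a ≠ 0 → 0 < NPath.pathDiscr d F s a) →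
      NPath.IsStrictlyHyperbolic F (NPath.e₀ n)) := by
  have hd0 : d ≠ 0 := Nat.one_le_iff_ne_zero.1 hd
  exact ⟨fun hhyp s _ a => NPath.pathDiscr_nonneg_of_isHyperbolic hd0 hF hhyp s a,
    fun h => NPath.isStrictlyHyperbolic_of_pathDiscr_ne_zero hd0 hF
      fun s hs a ha => (h s hs a ha).ne'⟩
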